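/- Let $M\ge 1$ and $\mathcal X=\mathcal X_1\times\dots\times\mathcal X_M$ with $\mathcal X_m=\mathbb R^{d_m}$, and $d=d_1+\dots+d_M$. For $x\in\mathcal X$ write $x_{-m}=(x_i)_{i\ne m}$, and write $(y_m,x_{-m})$ for the point obtained from $x$ by replacing its $m$-th block by $y_m$. Let $\pi$ be a probability measure on $\mathcal X=\mathbb R^d$ with Lebesgue density $\exp(-U)$, where $$U(x)=U_0(x)+\sum_{m=1}^M U_m(x_m),$$ each $U_m:\mathbb R^{d_m}\to\mathbb R$ is convex, and $U_0:\mathbb R^d\to\mathbb R$ is of class $C^1$. Assume that there are constants $L_1,\dots,L_M\ge 0$ and $\lambda^*>0$ such that (i) for every $m$ and every $\bar x_{-m}$, the map $x_m\mapsto\nabla_mU_0(x_m,\bar x_{-m})$ is $L_m$-Lipschitz for the Euclidean norm of $\mathbb R^{d_m}$, where $\nabla_m$ denotes the gradient in the $m$-th block; (ii) the function $x\mapsto U_0(x)-\frac{\lambda^*}{2}\|x\|_L^2$ is convex, where $\|x\|_L^2=\sum_{m=1}^M L_m\|x_m\|^2$, and $\|\cdot\|_L$ is not identically zero on $\mathbb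 R^d$. Put $\kappa^*=1/\lambda^*$. Let $\pi(\cdot\mid x_{-m})$ be the regular conditional distribution under $\pi$ of the $m$-th block given the other blocks, and define the Markov kernels $$P_m(x,A)=\int_{\mathcal X_m}\mathbf 1_A(y_m,x_{-m})\,\pi(\mathrm dy_m\mid x_{-m}),\qquad P^{\mathrm{GS}}=\frac1M\sum_{m=1}^M P_m .$$ For a probability measure $\mu$ let $\mu P^{\mathrm{GS}}(A)=\int P^{\mathrm{GS}}(x,A)\,\mu(\mathrm dx)$, and let $\mathrm{KL}(\mu|\pi)=\int\log\frac{\mathrm d\mu}{\mathrm d\pi}\,\mathrm d\mu\in[0,+\infty]$ if $\mu\ll\pi$ and $\mathrm{KL}(\mu|\pi)=+\infty$ otherwise. Then for every Borel probability measure $\mu$ on $\mathbb R^d$, $$\mathrm{KL}(\mu P^{\mathrm{GS}}|\pi)\le\Big(1-\frac1{\kappa^*M}\Big)\,\mathrm{KL}(\mu|\pi),$$ with the convention $0\cdot\infty=0$. -/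

import Mathlib

open MeasureTheory ProbabilityTheory InformationTheory
open scoped ENNReal NNReal

/-- The space `ℝ^{d₁} × ⋯ × ℝ^{d_M}`, with its Borel σ-algebra and Lebesgue measure `volume`. -/
abbrev BlockSpace {M : ℕ} (d : Fin M → ℕ) : Type :=
  (m : Fin M) → EuclideanSpace ℝ (Fin (d m))

/-- The space `𝒳_{-m} = ∏_{i ≠ m} ℝ^{d_i}`. -/
abbrev BlockCompl {M : ℕ} (d : Fin M → ℕ) (m : Fin M) : Type :=
  (i : {i : Fin M // i ≠ m}) → EuclideanSpace ℝ (Fin (d i))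

/-- The projection `x ↦ x_{-m}`. -/
def dropBlock {M : ℕ} {d : Fin M → ℕ} (m : Fin M) (x : BlockSpace d) : BlockCompl d m :=
  fun i => x i

theorem measurable_dropBlock {M : ℕ} {d : Fin M → ℕ} (m : Fin M) :
    Measurable (dropBlock (d := d) m) :=
  measurable_pi_lambda _ fun i => measurable_pi_apply (i : Fin M)

/-- The point `(y_m, x_{-m})`: the `m`-th block of `x` is replaced by `y`. -/
def replaceBlock {M : ℕ} {d : Fin M → ℕ} (m : Fin M) (x : BlockSpace d)
    (y : EuclideanSpace ℝ (Fin (d m))) : BlockSpace d :=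
  Function.update x m y

theorem measurable_replaceBlock {M : ℕ} {d : Fin M → ℕ} (m : Fin M) :
    Measurable (fun p : BlockSpace d × EuclideanSpace ℝ (Fin (d m)) =>
      replaceBlock m p.1 p.2) := by
  refine measurable_pi_lambda _ fun i => ?_
  by_cases h : i = m
  · subst h
    simpa [replaceBlock] using measurable_snd
  · simp only [replaceBlock, Function.update_of_ne h]
    exact (measurable_pi_apply i).comp measurable_fst

/-- The gradient `∇_m f (x)` of `f` with respect to the `m`-th block. -/
noncomputable def blockGradient {M : ℕ} {d : Fin M → ℕ} (m : Fin M) (f : BlockSpace d → ℝ)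
    (x : BlockSpace d) : EuclideanSpace ℝ (Fin (d m)) :=
  gradient (fun y => f (replaceBlock m x y)) (x m)

/-- The weighted squared norm `‖x‖_L² = ∑ₘ L_m ‖x_m‖²` (each `‖x_m‖` is Euclidean). -/
noncomputable def weightedNormSq {M : ℕ} {d : Fin M → ℕ} (L : Fin M → ℝ≥0)
    (x : BlockSpace d) : ℝ :=
  ∑ m, (L m : ℝ) * ‖x m‖ ^ 2

/-- Block log-concavity of `π`: `π = exp (-U)` with `U x = U₀ x + ∑ₘ U_m (x_m)`, where the `U_m`
are convex, `U₀` is `C¹`, block-wise smooth with constants `L_m`, and `lam`-convex with respect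
to `‖·‖_L`. The seminorm `‖·‖_L` must not vanish identically (otherwise `lam` is unconstrained);
single constants `L_m` may be zero. -/
structure IsBlockLogConcave {M : ℕ} {d : Fin M → ℕ} (π : Measure (BlockSpace d))
    (U₀ : BlockSpace d → ℝ) (U : (m : Fin M) → EuclideanSpace ℝ (Fin (d m)) → ℝ)
    (L : Fin M → ℝ≥0) (lam : ℝ) : Prop where
  eq_withDensity : π = (volume : Measure (BlockSpace d)).withDensity
    (fun x => ENNReal.ofReal (Real.exp (-(U₀ x + ∑ m, U m (x m)))))
  convex_block : ∀ m, ConvexOn ℝ Set.univ (U m)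
  contDiff : ContDiff ℝ 1 U₀
  smooth_block : ∀ (m : Fin M) (x : BlockSpace d),
    LipschitzWith (L m) (fun y => blockGradient m U₀ (replaceBlock m x y))
  lam_pos : 0 < lam
  strong_convex : ConvexOn ℝ Set.univ (fun x => U₀ x - lam / 2 * weightedNormSq L x)
  weight_ne_zero : ∃ x : BlockSpace d, weightedNormSq L x ≠ 0

/-- The regular conditional distribution `π(· | x_{-m})` of the `m`-th block given the others. -/
noncomputable def fullConditional {M : ℕ} {d : Fin M → ℕ} (π : Measure (BlockSpace d))
    [IsFiniteMeasure π] (m : Fin M) :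
    Kernel (BlockCompl d m) (EuclideanSpace ℝ (Fin (d m))) :=
  condDistrib (fun x : BlockSpace d => x m) (dropBlock m) π

/-- The single-block kernel `P_m`: keep `x_{-m}` and redraw block `m` from `π(· | x_{-m})`. -/
noncomputable def blockKernel {M : ℕ} {d : Fin M → ℕ} (π : Measure (BlockSpace d))
    [IsFiniteMeasure π] (m : Fin M) : Kernel (BlockSpace d) (BlockSpace d) :=
  (Kernel.id ×ₖ (fullConditional π m).comap (dropBlock m) (measurable_dropBlock m)).map
    (fun p => replaceBlock m p.1 p.2)

/-- `P_m(x, A) = ∫ 1_A(y_m, x_{-m}) π(dy | x_{-m})`. -/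
theorem blockKernel_apply {M : ℕ} {d : Fin M → ℕ} (π : Measure (BlockSpace d))
    [IsFiniteMeasure π] (m : Fin M) (x : BlockSpace d) {A : Set (BlockSpace d)}
    (hA : MeasurableSet A) :
    blockKernel π m x A =
      ∫⁻ y, A.indicator 1 (replaceBlock m x y) ∂(fullConditional π m (dropBlock m x)) := by
  have : IsMarkovKernel (fullConditional π m) := by
    unfold fullConditional; infer_instance
  have hm := measurable_replaceBlock (d := d) m
  rw [blockKernel, Kernel.map_apply' _ hm _ hA, Kernel.id_prod_apply' _ _ (hm hA),
    Kernel.comap_apply]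
  have hB : MeasurableSet {y | replaceBlock m x y ∈ A} :=
    (hm.comp measurable_prodMk_left) hA
  exact (lintegral_indicator_one hB).symm

/-- The random-scan Gibbs kernel `P^GS = (1/M) ∑ₘ P_m`. -/
noncomputable def gibbsKernel {M : ℕ} {d : Fin M → ℕ} (π : Measure (BlockSpace d))
    [IsFiniteMeasure π] : Kernel (BlockSpace d) (BlockSpace d) where
  toFun x := (M : ℝ≥0∞)⁻¹ • ∑ m, blockKernel π m x
  measurable' := by
    refine Measure.measurable_of_measurable_coe _ fun s hs => ?_
    simp only [Measure.smul_apply, Measure.finsetSum_apply, smul_eq_mul]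
    exact (Finset.measurable_fun_sum _ fun m _ =>
      (blockKernel π m).measurable_coe hs).const_mul _

/-- The coordinate-wise condition number `κ* = 1 / λ*`. -/
noncomputable def kappaStar (lam : ℝ) : ℝ := 1 / lam

/-! Write `μ_{-m}` for the law of `x_{-m}` under `μ`. Since `μ P_m` and `π` are glued from `μ_{-m}`
and `π_{-m}` by the same conditional kernel, `KL(μ P_m|π) ≤ KL(μ_{-m}|π_{-m})`. By convexity of
entropy it suffices to prove `∑ KL(μ_{-m}|π_{-m}) ≤ (M - t) KL(μ|π)` for `0 < t < λ*` and let `t`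
tend to `λ*`.

By duality (`sum_klDiv_map_le`) this follows from the Loomis-Whitney type bound `(∫ (∏
φ_k(x_{-k}))^{1/(M-t)} dπ)^{M-t} ≤ ∏ ∫ φ_k(x_{-k}) dπ`, applied to the marginal densities.

That bound is an instance of a multi-block Prékopa-Leindler inequality (`prekopa_leindler_block`),
where the `k`-th factor on the right is evaluated at `x` with only block `k` moved towards `y` by
the fraction `t`. Such a move leaves `x_{-k}`, hence `φ_k`, unchanged, so only the potential must be
controlled: `∑_k V(segment_k) ≤ (M - t) V(x) + t V(y)`. Block smoothness costs `t²/2 ‖y - x‖_L²` and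
strong convexity gains `t λ*/2 ‖y - x‖_L²`, so `t ≤ λ*` is exactly enough
(`sum_potential_blockSegment_le`). -/

/-! ### Brunn-Minkowski and Prékopa-Leindler on the line -/

/-- The translates `A + min B` and `max A + B` both lie in `C` and can meet only at the point `max A
+ min B`. -/
theorem IsCompact.volume_add_le_of_forall_add_mem {A B C : Set ℝ} (hA : IsCompact A)
    (hB : IsCompact B) (hA' : A.Nonempty) (hB' : B.Nonempty)
    (h : ∀ a ∈ A, ∀ b ∈ B, a + b ∈ C) : volume A + volume B ≤ volume C := by
  obtain ⟨a, haA, ha⟩ := hA.exists_isGreatest hA'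
  obtain ⟨b, hbB, hb⟩ := hB.exists_isLeast hB'
  have h1 : volume ((fun x => -b + x) ⁻¹' A) = volume A := measure_preimage_add _ _ _
  have h2 : volume ((fun x => -a + x) ⁻¹' B) = volume B := measure_preimage_add _ _ _
  rw [← h1, ← h2, ← measure_union₀]
  · refine measure_mono ?_
    rintro x (hx | hx)
    · simpa using h _ hx b hbB
    · simpa using h a haA _ hx
  · exact ((measurable_const_add _) hB.measurableSet).nullMeasurableSet
  · refine measure_mono_null (t := {a + b}) ?_ (by simp)
    rintro x ⟨hx, hy⟩
    have := ha hx
    have := hb hy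
    simp only [Set.mem_singleton_iff]
    linarith

theorem Real.volume_add_le_of_forall_add_mem {A B C : Set ℝ} (hA : MeasurableSet A)
    (hB : MeasurableSet B) (hA' : A.Nonempty) (hB' : B.Nonempty)
    (h : ∀ a ∈ A, ∀ b ∈ B, a + b ∈ C) : volume A + volume B ≤ volume C := by
  obtain ⟨a₀, ha₀⟩ := hA'
  obtain ⟨b₀, hb₀⟩ := hB'
  rw [hA.measure_eq_iSup_isCompact, hB.measure_eq_iSup_isCompact]
  simp only [iSup_and']
  refine ENNReal.biSup_add_biSup_le' (p := fun K => K ⊆ A ∧ IsCompact K)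
    (q := fun K => K ⊆ B ∧ IsCompact K) ⟨∅, by simp⟩ ⟨∅, by simp⟩ ?_
  rintro K ⟨hKA, hK⟩ K' ⟨hKB, hK'⟩
  -- The approximating compacts may be empty; adding one point of each set keeps them compact and
  -- makes them nonempty.
  calc volume K + volume K' ≤ volume (insert a₀ K) + volume (insert b₀ K') := by
        gcongr <;> exact Set.subset_insert _ _
    _ ≤ volume C := (hK.insert a₀).volume_add_le_of_forall_add_mem (hK'.insert b₀)
        (Set.insert_nonempty _ _) (Set.insert_nonempty _ _) fun a ha b hb =>
          h a (Set.insert_subset ha₀ hKA ha) b (Set.insert_subset hb₀ hKB hb)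

/-- The one-dimensional Brunn-Minkowski inequality. -/
theorem Real.volume_convexCombination_le {A B C : Set ℝ} (hA : MeasurableSet A)
    (hB : MeasurableSet B) (hA' : A.Nonempty) (hB' : B.Nonempty) {t : ℝ} (ht₀ : 0 < t)
    (ht₁ : t < 1) (h : ∀ a ∈ A, ∀ b ∈ B, (1 - t) * a + t * b ∈ C) :
    ENNReal.ofReal (1 - t) * volume A + ENNReal.ofReal t * volume B ≤ volume C := by
  open scoped Pointwise in
  have h1 := Measure.addHaar_smul (volume : Measure ℝ) (1 - t) A
  have h2 := Measure.addHaar_smul (volume : Measure ℝ) t B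
  simp only [Module.finrank_self, pow_one, abs_of_pos ht₀, abs_of_pos (sub_pos.2 ht₁)] at h1 h2
  rw [← h1, ← h2]
  refine Real.volume_add_le_of_forall_add_mem (hA.const_smul_of_ne_zero (sub_pos.2 ht₁).ne')
    (hB.const_smul_of_ne_zero ht₀.ne') hA'.smul_set hB'.smul_set ?_
  rintro _ ⟨a, ha, rfl⟩ _ ⟨b, hb, rfl⟩
  exact h a ha b hb

theorem ENNReal.geom_mean_le_arith_mean2_weighted {t : ℝ} (ht₀ : 0 < t) (ht₁ : t < 1)
    (a b : ℝ≥0∞) :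
    a ^ (1 - t) * b ^ t ≤ ENNReal.ofReal (1 - t) * a + ENNReal.ofReal t * b := by
  have ht₁' := sub_pos.2 ht₁
  rcases eq_or_ne a ⊤ with rfl | ha
  · rw [ENNReal.mul_top (by simpa using ht₁)]; simp
  rcases eq_or_ne b ⊤ with rfl | hb
  · rw [ENNReal.mul_top (a := ENNReal.ofReal t) (by simpa using ht₀)]; simp
  lift a to ℝ≥0 using ha
  lift b to ℝ≥0 using hb
  have := NNReal.geom_mean_le_arith_mean2_weighted (1 - t).toNNReal t.toNNReal a b (by
    rw [← Real.toNNReal_add ht₁'.le ht₀.le]; simp)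
  rw [Real.coe_toNNReal _ ht₁'.le, Real.coe_toNNReal _ ht₀.le] at this
  rw [← ENNReal.coe_rpow_of_nonneg _ ht₁'.le, ← ENNReal.coe_rpow_of_nonneg _ ht₀.le]
  simp only [ENNReal.ofReal]
  exact_mod_cast this

theorem lintegral_eq_lintegral_meas_ofReal_lt {α : Type*} [MeasurableSpace α] (μ : Measure α)
    {f : α → ℝ≥0∞} (hf : Measurable f) (hf' : ∀ x, f x ≠ ⊤) :
    ∫⁻ x, f x ∂μ = ∫⁻ r in Set.Ioi (0 : ℝ), μ {x | ENNReal.ofReal r < f x} := by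
  have := lintegral_eq_lintegral_meas_lt μ (f := fun x => (f x).toReal)
    (Filter.Eventually.of_forall fun x => ENNReal.toReal_nonneg) hf.ennreal_toReal.aemeasurable
  simp only [ENNReal.ofReal_toReal (hf' _)] at this
  rw [this]
  refine setLIntegral_congr_fun measurableSet_Ioi fun r hr => ?_
  simp only [ENNReal.ofReal_lt_iff_lt_toReal (le_of_lt hr) (hf' _)]

/-- With equal suprema, the superlevel sets of `f` and `g` are nonempty for the same levels, so
Brunn-Minkowski applies level by level and the layer-cake formula integrates the result. This yields
the stronger bound with the arithmetic mean of the integrals. -/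
theorem Real.prekopa_leindler_of_iSup_eq_one {t : ℝ} (ht₀ : 0 < t) (ht₁ : t < 1)
    {f g h : ℝ → ℝ≥0∞} (hf : Measurable f) (hg : Measurable g) (hh : Measurable h)
    (hf' : ⨆ x, f x = 1) (hg' : ⨆ x, g x = 1) (hh' : ∀ x, h x ≠ ⊤)
    (H : ∀ u v, f u ^ (1 - t) * g v ^ t ≤ h ((1 - t) * u + t * v)) :
    (∫⁻ x, f x) ^ (1 - t) * (∫⁻ x, g x) ^ t ≤ ∫⁻ x, h x := by
  have ht₁' := sub_pos.2 ht₁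
  have hf1 : ∀ x, f x ≤ 1 := fun x => hf' ▸ le_iSup f x
  have hg1 : ∀ x, g x ≤ 1 := fun x => hg' ▸ le_iSup g x
  refine (ENNReal.geom_mean_le_arith_mean2_weighted ht₀ ht₁ _ _).trans ?_
  rw [lintegral_eq_lintegral_meas_ofReal_lt _ hf fun x => ((hf1 x).trans_lt (by simp)).ne,
    lintegral_eq_lintegral_meas_ofReal_lt _ hg fun x => ((hg1 x).trans_lt (by simp)).ne,
    lintegral_eq_lintegral_meas_ofReal_lt _ hh hh']
  have mf : Measurable fun r : ℝ => volume {x | ENNReal.ofReal r < f x} :=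
    Antitone.measurable fun r s hrs => measure_mono fun x hx =>
      (ENNReal.ofReal_le_ofReal hrs).trans_lt hx
  have mg : Measurable fun r : ℝ => volume {x | ENNReal.ofReal r < g x} :=
    Antitone.measurable fun r s hrs => measure_mono fun x hx =>
      (ENNReal.ofReal_le_ofReal hrs).trans_lt hx
  rw [← lintegral_const_mul _ mf, ← lintegral_const_mul _ mg,
    ← lintegral_add_left (mf.const_mul _)]
  refine lintegral_mono fun r => ?_
  rcases lt_or_ge (ENNReal.ofReal r) 1 with hr | hr
  · have hAne : {x | ENNReal.ofReal r < f x}.Nonempty := lt_iSup_iff.1 (hr.trans_eq hf'.symm)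
    have hBne : {x | ENNReal.ofReal r < g x}.Nonempty := lt_iSup_iff.1 (hr.trans_eq hg'.symm)
    refine Real.volume_convexCombination_le (measurableSet_lt measurable_const hf)
      (measurableSet_lt measurable_const hg) hAne hBne
      ht₀ ht₁ fun u hu v hv => ?_
    refine lt_of_lt_of_le ?_ (H u v)
    calc ENNReal.ofReal r = ENNReal.ofReal r ^ (1 - t) * ENNReal.ofReal r ^ t := by
          rw [← ENNReal.rpow_add_of_nonneg _ _ ht₁'.le ht₀.le]; simp
      _ < f u ^ (1 - t) * g v ^ t :=
        ENNReal.mul_lt_mul (ENNReal.rpow_lt_rpow hu ht₁') (ENNReal.rpow_lt_rpow hv ht₀)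
  · have h1 : {x | ENNReal.ofReal r < f x} = ∅ :=
      Set.eq_empty_of_forall_notMem fun x hx => (hx.trans_le (hf1 x)).not_ge hr
    have h2 : {x | ENNReal.ofReal r < g x} = ∅ :=
      Set.eq_empty_of_forall_notMem fun x hx => (hx.trans_le (hg1 x)).not_ge hr
    simp [h1, h2]

/-- The inequality is homogeneous: dividing `f` and `g` by their suprema, and `h` by the matching
geometric mean, reduces to suprema equal to one. -/
theorem Real.prekopa_leindler_of_bounded {t : ℝ} (ht₀ : 0 < t) (ht₁ : t < 1)
    {f g h : ℝ → ℝ≥0∞} (hf : Measurable f) (hg : Measurable g) (hh : Measurable h)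
    {c : ℝ≥0∞} (hc : c ≠ ⊤) (hf' : ∀ x, f x ≤ c) (hg' : ∀ x, g x ≤ c) (hh' : ∀ x, h x ≤ c)
    (H : ∀ u v, f u ^ (1 - t) * g v ^ t ≤ h ((1 - t) * u + t * v)) :
    (∫⁻ x, f x) ^ (1 - t) * (∫⁻ x, g x) ^ t ≤ ∫⁻ x, h x := by
  have ht₁' := sub_pos.2 ht₁
  set a := ⨆ x, f x with ha
  set b := ⨆ x, g x with hb
  have ha_top : a ≠ ⊤ := ((iSup_le hf').trans_lt hc.lt_top).ne
  have hb_top : b ≠ ⊤ := ((iSup_le hg').trans_lt hc.lt_top).ne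
  rcases eq_or_ne a 0 with ha0 | ha0
  · have : ∀ x, f x = 0 := by simpa [ha] using ha0
    simp [this, ht₁']
  rcases eq_or_ne b 0 with hb0 | hb0
  · have : ∀ x, g x = 0 := by simpa [hb] using hb0
    simp [this, ht₀]
  have key := Real.prekopa_leindler_of_iSup_eq_one ht₀ ht₁ (hf.const_mul a⁻¹)
    (hg.const_mul b⁻¹) (hh.const_mul (a⁻¹ ^ (1 - t) * b⁻¹ ^ t))
    (by rw [← ENNReal.mul_iSup]; exact ENNReal.inv_mul_cancel ha0 ha_top)
    (by rw [← ENNReal.mul_iSup]; exact ENNReal.inv_mul_cancel hb0 hb_top)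
    (fun x => ENNReal.mul_ne_top (ENNReal.mul_ne_top
      (ENNReal.rpow_ne_top_of_nonneg ht₁'.le (by simpa))
      (ENNReal.rpow_ne_top_of_nonneg ht₀.le (by simpa))) ((hh' x).trans_lt hc.lt_top).ne)
    (fun u v => by
      rw [ENNReal.mul_rpow_of_nonneg _ _ ht₁'.le, ENNReal.mul_rpow_of_nonneg _ _ ht₀.le,
        mul_mul_mul_comm]
      gcongr
      exact H u v)
  rw [lintegral_const_mul _ hf, lintegral_const_mul _ hg, lintegral_const_mul _ hh,
    ENNReal.mul_rpow_of_nonneg _ _ ht₁'.le, ENNReal.mul_rpow_of_nonneg _ _ ht₀.le,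
    mul_mul_mul_comm] at key
  refine (ENNReal.mul_le_mul_iff_right ?_ ?_).1 key
  · have h1 : a⁻¹ ^ (1 - t) ≠ 0 := by simp [ENNReal.rpow_eq_zero_iff, ha_top, ha0]
    have h2 : b⁻¹ ^ t ≠ 0 := by simp [ENNReal.rpow_eq_zero_iff, hb_top, hb0]
    exact mul_ne_zero h1 h2
  · exact ENNReal.mul_ne_top (ENNReal.rpow_ne_top_of_nonneg ht₁'.le (by simpa))
      (ENNReal.rpow_ne_top_of_nonneg ht₀.le (by simpa))

theorem tendsto_lintegral_min_natCast {α : Type*} [MeasurableSpace α] (μ : Measure α)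
    {f : α → ℝ≥0∞} (hf : Measurable f) :
    Filter.Tendsto (fun n : ℕ => ∫⁻ x, min (f x) n ∂μ) Filter.atTop (nhds (∫⁻ x, f x ∂μ)) := by
  refine lintegral_tendsto_of_tendsto_of_monotone (fun n => (hf.min measurable_const).aemeasurable)
    (Filter.Eventually.of_forall fun x n m hnm => by dsimp only; gcongr)
    (Filter.Eventually.of_forall fun x => ?_)
  have := (tendsto_const_nhds (x := f x)).min ENNReal.tendsto_nat_nhds_top
  simpa using this

/-- The one-dimensional Prékopa-Leindler inequality. -/
theorem Real.prekopa_leindler {t : ℝ} (ht₀ : 0 < t) (ht₁ : t < 1)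
    {f g h : ℝ → ℝ≥0∞} (hf : Measurable f) (hg : Measurable g) (hh : Measurable h)
    (H : ∀ u v, f u ^ (1 - t) * g v ^ t ≤ h ((1 - t) * u + t * v)) :
    (∫⁻ x, f x) ^ (1 - t) * (∫⁻ x, g x) ^ t ≤ ∫⁻ x, h x := by
  have ht₁' := sub_pos.2 ht₁
  rcases eq_or_ne (∫⁻ x, f x) 0 with hf0 | hf0
  · simp [hf0, ht₁']
  rcases eq_or_ne (∫⁻ x, g x) 0 with hg0 | hg0
  · simp [hg0, ht₀]
  -- Truncation at height `n` preserves the hypothesis. Nonzero integrals exclude `0 * ⊤` in the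
  -- limit of the product.
  have lim := ENNReal.Tendsto.mul
    ((ENNReal.continuous_rpow_const (y := 1 - t)).continuousAt.tendsto.comp
      (tendsto_lintegral_min_natCast volume hf))
    (Or.inl (by simp [ENNReal.rpow_eq_zero_iff, hf0, ht₁'.not_gt]))
    ((ENNReal.continuous_rpow_const (y := t)).continuousAt.tendsto.comp
      (tendsto_lintegral_min_natCast volume hg))
    (Or.inl (by simp [ENNReal.rpow_eq_zero_iff, hg0, ht₀.not_gt]))
  refine le_of_tendsto' lim fun n => ?_
  refine (Real.prekopa_leindler_of_bounded ht₀ ht₁ (hf.min measurable_const)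
    (hg.min measurable_const) (hh.min measurable_const) (ENNReal.natCast_ne_top n)
    (fun x => min_le_right _ _) (fun x => min_le_right _ _) (fun x => min_le_right _ _)
    fun u v => le_min ?_ ?_).trans (lintegral_mono fun x => min_le_left _ _)
  · refine le_trans ?_ (H u v)
    gcongr <;> exact min_le_left _ _
  · calc min (f u) n ^ (1 - t) * min (g v) n ^ t ≤ (n : ℝ≥0∞) ^ (1 - t) * (n : ℝ≥0∞) ^ t := by
          gcongr <;> exact min_le_right _ _
      _ = n := by
          rw [← ENNReal.rpow_add_of_nonneg _ _ ht₁'.le ht₀.le]; simp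

/-! ### Prékopa-Leindler in several dimensions and for blocks -/

/-- The Prékopa-Leindler inequality for partial integrals on `ℝⁿ`. -/
theorem prekopa_leindler_lmarginal {ι : Type*} [DecidableEq ι] {t : ℝ} (ht₀ : 0 < t)
    (ht₁ : t < 1) {f g h : (ι → ℝ) → ℝ≥0∞} (hf : Measurable f) (hg : Measurable g)
    (hh : Measurable h) (H : ∀ u v, f u ^ (1 - t) * g v ^ t ≤ h ((1 - t) • u + t • v))
    (s : Finset ι) (u v : ι → ℝ) :
    (lmarginal (fun _ => volume) s f u) ^ (1 - t) * (lmarginal (fun _ => volume) s g v) ^ t ≤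
      lmarginal (fun _ => volume) s h ((1 - t) • u + t • v) := by
  induction s using Finset.induction generalizing u v with
  | empty => simpa using H u v
  | insert i s hi ih =>
    rw [lmarginal_insert _ hf hi, lmarginal_insert _ hg hi, lmarginal_insert _ hh hi]
    refine Real.prekopa_leindler ht₀ ht₁ (hf.lmarginal _ |>.comp (measurable_update u))
      (hg.lmarginal _ |>.comp (measurable_update v))
      (hh.lmarginal _ |>.comp (measurable_update _)) fun a b => ?_
    refine (ih _ _).trans (le_of_eq ?_)
    congr 1
    ext j
    rcases eq_or_ne j i with rfl | hj <;> simp [*]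

/-- The Prékopa-Leindler inequality on Euclidean space. -/
theorem EuclideanSpace.prekopa_leindler {n : ℕ} {t : ℝ} (ht₀ : 0 < t)
    (ht₁ : t < 1) {f g h : EuclideanSpace ℝ (Fin n) → ℝ≥0∞} (hf : Measurable f)
    (hg : Measurable g) (hh : Measurable h)
    (H : ∀ u v, f u ^ (1 - t) * g v ^ t ≤ h ((1 - t) • u + t • v)) :
    (∫⁻ x, f x) ^ (1 - t) * (∫⁻ x, g x) ^ t ≤ ∫⁻ x, h x := by
  have mp := PiLp.volume_preserving_toLp (Fin n)
  have e := prekopa_leindler_lmarginal ht₀ ht₁ (hf.comp mp.measurable) (hg.comp mp.measurable)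
    (hh.comp mp.measurable) (fun u v => H _ _) Finset.univ 0 0
  simp only [lmarginal_univ, Function.comp_apply] at e
  rw [← mp.lintegral_comp hf, ← mp.lintegral_comp hg, ← mp.lintegral_comp hh]
  exact e

/-- A Prékopa-Leindler inequality for products, in which only the factor `h i₀` is evaluated at
the convex combination. -/
theorem EuclideanSpace.prekopa_leindler_prod {n : ℕ} {ι : Type*} [Fintype ι] [DecidableEq ι]
    (i₀ : ι) {t : ℝ} (ht₀ : 0 < t) (ht₁ : t < 1) {f g : EuclideanSpace ℝ (Fin n) → ℝ≥0∞}
    {h : ι → EuclideanSpace ℝ (Fin n) → ℝ≥0∞} (hf : Measurable f) (hg : Measurable g)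
    (hh : ∀ i, Measurable (h i)) (hpos : ∀ i u, h i u ≠ 0)
    (H : ∀ u v, f u ^ (Fintype.card ι - t) * g v ^ t ≤
      ∏ i, h i (if i = i₀ then (1 - t) • u + t • v else u)) :
    (∫⁻ x, f x) ^ (Fintype.card ι - t) * (∫⁻ x, g x) ^ t ≤ ∏ i, ∫⁻ x, h i x := by
  have ht₁' := sub_pos.2 ht₁
  have hcard : (1 : ℝ) ≤ Fintype.card ι := by
    exact_mod_cast Fintype.card_pos_iff.2 ⟨i₀⟩
  set p : ℝ := Fintype.card ι - t with hp
  have hp0 : 0 < p := by linarith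
  have hint : ∀ i, ∫⁻ x, h i x ≠ 0 := fun i hi => by
    rw [lintegral_eq_zero_iff (hh i)] at hi
    obtain ⟨x, hx⟩ := hi.exists
    exact hpos i x hx
  by_cases htop : ∃ i, ∫⁻ x, h i x = ⊤
  · obtain ⟨i, hi⟩ := htop
    rw [← Finset.mul_prod_erase _ _ (Finset.mem_univ i), hi,
      ENNReal.top_mul (Finset.prod_ne_zero_iff.2 fun j _ => hint j)]
    exact le_top
  push Not at htop
  set s := Finset.univ.erase i₀ with hs
  set A : EuclideanSpace ℝ (Fin n) → ℝ≥0∞ := fun u => ∏ i ∈ s, h i u with hA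
  have mA : Measurable A := Finset.measurable_fun_prod _ fun i _ => hh i
  have hA0 : ∀ u, A u ≠ 0 := fun u => Finset.prod_ne_zero_iff.2 fun i _ => hpos i u
  have hAtop : ∀ᵐ u, A u ≠ ⊤ := by
    have : ∀ᵐ u, ∀ i, h i u < ⊤ := ae_all_iff.2 fun i => ae_lt_top (hh i) (htop i)
    filter_upwards [this] with u hu
    exact ENNReal.prod_ne_top fun i _ => (hu i).ne
  -- `F` is chosen so that `F(u)^(1-t) g(v)^t ≤ h i₀ ((1-t)u + tv)`, the plain Prékopa-Leindler
  -- hypothesis. The factors fixed at `u` are then restored by Hölder.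
  set F : EuclideanSpace ℝ (Fin n) → ℝ≥0∞ := fun u => (f u ^ p / A u) ^ (1 - t)⁻¹ with hF
  have mF : Measurable F := ((hf.pow_const p).div mA).pow_const _
  have F_pow : ∀ u, F u ^ (1 - t) = f u ^ p / A u := fun u => by
    rw [hF, ← ENNReal.rpow_mul, inv_mul_cancel₀ ht₁'.ne', ENNReal.rpow_one]
  have PL := EuclideanSpace.prekopa_leindler ht₀ ht₁ mF hg (hh i₀) fun u v => by
    rw [F_pow, ENNReal.div_eq_inv_mul, mul_assoc, ← ENNReal.div_eq_inv_mul]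
    refine ENNReal.div_le_of_le_mul ((H u v).trans_eq ?_)
    rw [← Finset.mul_prod_erase _ _ (Finset.mem_univ i₀), if_pos rfl]
    congr 1
    exact Finset.prod_congr rfl fun i hi => by rw [if_neg (Finset.ne_of_mem_erase hi)]
  -- Almost everywhere `f = F^((1-t)/p) * ∏ (h i)^(1/p)`, and the exponents sum to `((1-t) + (card ι
  -- - 1)) / p = 1`.
  have hoelder : (∫⁻ x, f x) ≤ (∫⁻ x, F x) ^ ((1 - t) / p) * ∏ i ∈ s, (∫⁻ x, h i x) ^ p⁻¹ := by
    refine le_trans (lintegral_mono_ae ?_) (ENNReal.lintegral_mul_prod_norm_pow_le s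
      mF.aemeasurable (fun i _ => (hh i).aemeasurable) (q := (1 - t) / p) (p := fun _ => p⁻¹)
      ?_ (by positivity) (fun _ _ => by positivity))
    · filter_upwards [hAtop] with u hu
      rw [ENNReal.prod_rpow_of_nonneg (by positivity), div_eq_mul_inv (1 - t), ENNReal.rpow_mul,
        F_pow, ← ENNReal.mul_rpow_of_nonneg _ _ (by positivity),
        ENNReal.div_mul_cancel (hA0 u) hu, ← ENNReal.rpow_mul, mul_inv_cancel₀ hp0.ne',
        ENNReal.rpow_one]
    · rw [Finset.sum_const, hs, Finset.card_erase_of_mem (Finset.mem_univ _), Finset.card_univ,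
        nsmul_eq_mul, Nat.cast_pred (Fintype.card_pos_iff.2 ⟨i₀⟩)]
      field_simp
      rw [hp]; ring
  calc (∫⁻ x, f x) ^ p * (∫⁻ x, g x) ^ t
      ≤ ((∫⁻ x, F x) ^ ((1 - t) / p) * ∏ i ∈ s, (∫⁻ x, h i x) ^ p⁻¹) ^ p * (∫⁻ x, g x) ^ t := by
        gcongr
    _ = ((∫⁻ x, F x) ^ (1 - t) * (∫⁻ x, g x) ^ t) * ∏ i ∈ s, ∫⁻ x, h i x := by
        rw [ENNReal.prod_rpow_of_nonneg (by positivity), ENNReal.mul_rpow_of_nonneg _ _ hp0.le,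
          ← ENNReal.rpow_mul, ← ENNReal.rpow_mul, div_mul_cancel₀ _ hp0.ne',
          inv_mul_cancel₀ hp0.ne', ENNReal.rpow_one]
        ring
    _ ≤ (∫⁻ x, h i₀ x) * ∏ i ∈ s, ∫⁻ x, h i x := by gcongr
    _ = ∏ i, ∫⁻ x, h i x :=
        Finset.mul_prod_erase _ (fun i => ∫⁻ x, h i x) (Finset.mem_univ i₀)

/-- The point obtained from `x` by replacing its `m`-th block by `(1 - t) x_m + t y_m`. -/
def blockSegment {M : ℕ} {d : Fin M → ℕ} (t : ℝ) (m : Fin M) (x y : BlockSpace d) :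
    BlockSpace d :=
  replaceBlock m x ((1 - t) • x m + t • y m)

theorem blockSegment_update {M : ℕ} {d : Fin M → ℕ} (t : ℝ) (k i : Fin M) (x y : BlockSpace d)
    (u v : EuclideanSpace ℝ (Fin (d i))) :
    blockSegment t k (Function.update x i u) (Function.update y i v) =
      Function.update (blockSegment t k x y) i (if k = i then (1 - t) • u + t • v else u) := by
  unfold blockSegment replaceBlock
  rcases eq_or_ne k i with rfl | hki
  · simp
  · rw [if_neg hki, Function.update_of_ne hki, Function.update_of_ne hki,
      Function.update_comm hki]

/-- The multi-block Prékopa-Leindler inequality, for partial integrals. -/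
theorem prekopa_leindler_block_lmarginal {M : ℕ} {d : Fin M → ℕ} {t : ℝ} (ht₀ : 0 < t)
    (ht₁ : t < 1) {f g : BlockSpace d → ℝ≥0∞} {h : Fin M → BlockSpace d → ℝ≥0∞}
    (hf : Measurable f) (hg : Measurable g) (hh : ∀ k, Measurable (h k))
    (hpos : ∀ k x, h k x ≠ 0)
    (H : ∀ x y, f x ^ (M - t) * g y ^ t ≤ ∏ k, h k (blockSegment t k x y))
    (s : Finset (Fin M)) :
    (∀ k x, lmarginal (fun _ => volume) s (h k) x ≠ 0) ∧ ∀ x y,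
      (lmarginal (fun _ => volume) s f x) ^ (M - t) * (lmarginal (fun _ => volume) s g y) ^ t ≤
      ∏ k, lmarginal (fun _ => volume) s (h k) (blockSegment t k x y) := by
  induction s using Finset.induction with
  | empty => simpa using ⟨hpos, H⟩
  | insert i s hi ih =>
    obtain ⟨ih0, ih⟩ := ih
    refine ⟨fun k x hx => ?_, fun x y => ?_⟩
    · rw [lmarginal_insert _ (hh k) hi] at hx
      obtain ⟨u, hu⟩ := ((lintegral_eq_zero_iff
        (((hh k).lmarginal (fun _ => volume) (s := s)).comp
          (measurable_update x (a := i)))).1 hx).exists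
      exact ih0 k _ hu
    · rw [lmarginal_insert _ hf hi, lmarginal_insert _ hg hi,
        Finset.prod_congr rfl fun k _ => lmarginal_insert _ (hh k) hi (blockSegment t k x y)]
      -- When block `i` is integrated, only the factor `k = i` sees the convex combination in that
      -- block; the others see `u`.
      have := EuclideanSpace.prekopa_leindler_prod i ht₀ ht₁
        (hf.lmarginal (fun _ => volume) (s := s) |>.comp (measurable_update x (a := i)))
        (hg.lmarginal (fun _ => volume) (s := s) |>.comp (measurable_update y (a := i)))
        (fun k => (hh k).lmarginal (fun _ => volume) (s := s) |>.comp
          (measurable_update (blockSegment t k x y) (a := i)))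
        (fun k u => ih0 k _) (fun u v => by
          rw [Fintype.card_fin]
          refine (ih _ _).trans (le_of_eq ?_)
          simp only [blockSegment_update, Function.comp_apply])
      simpa only [Fintype.card_fin, Function.comp_apply] using this

/-- The multi-block Prékopa-Leindler inequality. -/
theorem prekopa_leindler_block {M : ℕ} {d : Fin M → ℕ} {t : ℝ} (ht₀ : 0 < t)
    (ht₁ : t < 1) {f g : BlockSpace d → ℝ≥0∞} {h : Fin M → BlockSpace d → ℝ≥0∞}
    (hf : Measurable f) (hg : Measurable g) (hh : ∀ k, Measurable (h k))
    (hpos : ∀ k x, h k x ≠ 0)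
    (H : ∀ x y, f x ^ (M - t) * g y ^ t ≤ ∏ k, h k (blockSegment t k x y)) :
    (∫⁻ x, f x) ^ (M - t) * (∫⁻ x, g x) ^ t ≤ ∏ k, ∫⁻ x, h k x := by
  have := (prekopa_leindler_block_lmarginal ht₀ ht₁ hf hg hh hpos H Finset.univ).2 0 0
  simpa only [lmarginal_univ, ← volume_pi] using this

/-! ### Smoothness and convexity of the potential -/

/-- Along the segment from `x` to `x + v`, the value minus its claimed quadratic bound has
nonpositive derivative, by Cauchy-Schwarz and the Lipschitz bound. -/
theorem LipschitzWith.le_add_inner_gradient {E : Type*} [NormedAddCommGroup E]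
    [InnerProductSpace ℝ E] [CompleteSpace E] {φ : E → ℝ} (hφ : Differentiable ℝ φ) {L : ℝ≥0}
    (hL : LipschitzWith L (gradient φ)) (x v : E) :
    φ (x + v) ≤ φ x + inner ℝ (gradient φ x) v + L / 2 * ‖v‖ ^ 2 := by
  let ψ : ℝ → ℝ := fun r =>
    φ (x + r • v) - r * inner ℝ (gradient φ x) v - r ^ 2 * (L / 2 * ‖v‖ ^ 2)
  have hline : ∀ r : ℝ, HasDerivAt (fun r : ℝ => x + r • v) v r := fun r => by
    simpa using ((hasDerivAt_id r).smul_const v).const_add x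
  have hψ : ∀ r, HasDerivAt ψ (inner ℝ (gradient φ (x + r • v)) v - inner ℝ (gradient φ x) v
      - 2 * r * (L / 2 * ‖v‖ ^ 2)) r := fun r => by
    have h1 : HasDerivAt (fun r : ℝ => φ (x + r • v)) (inner ℝ (gradient φ (x + r • v)) v) r := by
      have := ((hφ (x + r • v)).hasGradientAt.hasFDerivAt).comp_hasDerivAt r (hline r)
      rwa [InnerProductSpace.toDual_apply_apply] at this
    have h2 := (hasDerivAt_id r).mul_const (inner ℝ (gradient φ x) v)
    have h3 := (hasDerivAt_pow 2 r).mul_const ((L : ℝ) / 2 * ‖v‖ ^ 2)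
    exact ((h1.sub h2).sub h3).congr_deriv (by simp)
  have hanti : AntitoneOn ψ (Set.Icc 0 1) := by
    refine antitoneOn_of_deriv_nonpos (convex_Icc _ _)
      (fun r _ => (hψ r).continuousAt.continuousWithinAt)
      (fun r _ => (hψ r).differentiableAt.differentiableWithinAt) fun r hr => ?_
    rw [interior_Icc] at hr
    rw [(hψ r).deriv, ← inner_sub_left]
    have h1 := real_inner_le_norm (gradient φ (x + r • v) - gradient φ x) v
    have h2 := hL.norm_sub_le (x + r • v) x
    rw [add_sub_cancel_left, norm_smul, Real.norm_of_nonneg hr.1.le] at h2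
    nlinarith [mul_le_mul_of_nonneg_right h2 (norm_nonneg v)]
  have := hanti (Set.left_mem_Icc.2 zero_le_one) (Set.right_mem_Icc.2 zero_le_one) zero_le_one
  simp only [ψ, one_smul, zero_smul, add_zero] at this
  linarith

section BlockSpace

variable {M : ℕ} {d : Fin M → ℕ}

theorem hasFDerivAt_replaceBlock {f : BlockSpace d → ℝ} (hf : Differentiable ℝ f) (m : Fin M)
    (x : BlockSpace d) (y : EuclideanSpace ℝ (Fin (d m))) :
    HasFDerivAt (fun y => f (replaceBlock m x y))
      ((fderiv ℝ f (replaceBlock m x y)).comp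
        (ContinuousLinearMap.pi (Pi.single m (ContinuousLinearMap.id ℝ _)))) y :=
  (hf _).hasFDerivAt.comp y (hasFDerivAt_update x y)

theorem replaceBlock_replaceBlock (m : Fin M) (x : BlockSpace d)
    (y z : EuclideanSpace ℝ (Fin (d m))) :
    replaceBlock m (replaceBlock m x y) z = replaceBlock m x z := by
  simp [replaceBlock]

theorem replaceBlock_self (m : Fin M) (x : BlockSpace d) : replaceBlock m x (x m) = x := by
  simp [replaceBlock]

theorem blockGradient_replaceBlock (m : Fin M) (f : BlockSpace d → ℝ) (x : BlockSpace d)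
    (y : EuclideanSpace ℝ (Fin (d m))) :
    blockGradient m f (replaceBlock m x y) = gradient (fun y => f (replaceBlock m x y)) y := by
  simp only [blockGradient, replaceBlock_replaceBlock]
  simp [replaceBlock]

theorem inner_blockGradient {f : BlockSpace d → ℝ} (hf : Differentiable ℝ f) (m : Fin M)
    (x : BlockSpace d) (v : EuclideanSpace ℝ (Fin (d m))) :
    inner ℝ (blockGradient m f x) v = fderiv ℝ f x (Pi.single m v) := by
  have h := (hasFDerivAt_replaceBlock hf m x (x m)).fderiv
  rw [blockGradient, gradient, InnerProductSpace.toDual_symm_apply, h, replaceBlock_self]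
  rw [ContinuousLinearMap.comp_apply]
  congr 1
  ext1 j
  rcases eq_or_ne j m with rfl | hj <;> simp [*]

theorem sum_inner_blockGradient {f : BlockSpace d → ℝ} (hf : Differentiable ℝ f)
    (x v : BlockSpace d) :
    ∑ m, inner ℝ (blockGradient m f x) (v m) = fderiv ℝ f x v := by
  simp only [inner_blockGradient hf]
  rw [← map_sum, Finset.univ_sum_single]

theorem weightedNormSq_segment (L : Fin M → ℝ≥0) (x v : BlockSpace d) (r : ℝ) :
    weightedNormSq L (x + r • v) = (1 - r) * weightedNormSq L x + r * weightedNormSq L (x + v)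
      - r * (1 - r) * weightedNormSq L v := by
  simp only [weightedNormSq, Finset.mul_sum, ← Finset.sum_add_distrib, ← Finset.sum_sub_distrib]
  refine Finset.sum_congr rfl fun m _ => ?_
  simp only [Pi.add_apply, Pi.smul_apply, norm_add_sq_real, inner_smul_right, norm_smul, mul_pow,
    Real.norm_eq_abs, sq_abs]
  ring

namespace IsBlockLogConcave

variable {π : Measure (BlockSpace d)} {U₀ : BlockSpace d → ℝ}
  {U : (m : Fin M) → EuclideanSpace ℝ (Fin (d m)) → ℝ} {L : Fin M → ℝ≥0} {lam : ℝ}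

theorem differentiable (hπ : IsBlockLogConcave π U₀ U L lam) : Differentiable ℝ U₀ :=
  hπ.contDiff.differentiable one_ne_zero

theorem fderiv_add_le (hπ : IsBlockLogConcave π U₀ U L lam) (x v : BlockSpace d) :
    U₀ x + fderiv ℝ U₀ x v + lam / 2 * weightedNormSq L v ≤ U₀ (x + v) := by
  have hd : HasDerivAt (fun r : ℝ => U₀ (x + r • v)) (fderiv ℝ U₀ x v) 0 := by
    have hline : HasDerivAt (fun r : ℝ => x + r • v) v 0 := by
      simpa using ((hasDerivAt_id (0 : ℝ)).smul_const v).const_add x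
    have h0 : HasFDerivAt U₀ (fderiv ℝ U₀ x) (x + (0 : ℝ) • v) := by
      simpa using (hπ.differentiable x).hasFDerivAt
    exact h0.comp_hasDerivAt 0 hline
  have hlim := (hasDerivAt_iff_tendsto_slope.1 hd).mono_left
    (nhdsWithin_mono 0 (fun r (hr : r ∈ Set.Ioi (0 : ℝ)) => (ne_of_gt hr : r ≠ 0)))
  have hlim' : Filter.Tendsto
      (fun r : ℝ => U₀ (x + v) - U₀ x - lam / 2 * (1 - r) * weightedNormSq L v)
      (nhdsWithin 0 (Set.Ioi 0))
      (nhds (U₀ (x + v) - U₀ x - lam / 2 * (1 - 0) * weightedNormSq L v)) := by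
    refine (Continuous.tendsto ?_ 0).mono_left nhdsWithin_le_nhds
    fun_prop
  have := le_of_tendsto_of_tendsto hlim hlim' ?_
  · linarith
  -- Convexity bounds the difference quotient at every `r` in `(0, 1)`; the quadratic term
  -- contributes `r (1 - r)`, so one factor `1 - r` survives division by `r`.
  filter_upwards [Ioo_mem_nhdsGT (zero_lt_one (α := ℝ))] with r hr
  rw [slope_def_field, sub_zero, zero_smul, add_zero, div_le_iff₀ hr.1]
  have hc := hπ.strong_convex.2 (Set.mem_univ x) (Set.mem_univ (x + v))
    (sub_nonneg.2 hr.2.le) hr.1.le (sub_add_cancel 1 r)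
  have e : (1 - r) • x + r • (x + v) = x + r • v := by module
  rw [e] at hc
  simp only [smul_eq_mul, weightedNormSq_segment L x v r] at hc
  linarith

theorem replaceBlock_le (hπ : IsBlockLogConcave π U₀ U L lam) (m : Fin M) (x : BlockSpace d)
    (v : EuclideanSpace ℝ (Fin (d m))) :
    U₀ (replaceBlock m x (x m + v)) ≤
      U₀ x + inner ℝ (blockGradient m U₀ x) v + L m / 2 * ‖v‖ ^ 2 := by
  have hL := hπ.smooth_block m x
  simp only [blockGradient_replaceBlock] at hL
  have := LipschitzWith.le_add_inner_gradient
    (fun y => (hasFDerivAt_replaceBlock hπ.differentiable m x y).differentiableAt) hL (x m) v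
  simpa only [replaceBlock_self, blockGradient] using this

/-- In a single block direction of positive weight, the quadratic lower bound with constant `lam * L
m` lies below the upper bound with constant `L m`. -/
theorem lam_le_one (hπ : IsBlockLogConcave π U₀ U L lam) : lam ≤ 1 := by
  obtain ⟨x, hx⟩ := hπ.weight_ne_zero
  obtain ⟨m, -, hm⟩ := Finset.exists_ne_zero_of_sum_ne_zero hx
  have h1 := hπ.replaceBlock_le m 0 (x m)
  have h2 := hπ.fderiv_add_le 0 (Pi.single m (x m))
  have e1 : replaceBlock m (0 : BlockSpace d) ((0 : BlockSpace d) m + x m)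
      = 0 + Pi.single m (x m) := by
    simp [replaceBlock, Pi.single]
  have e2 : weightedNormSq L (Pi.single m (x m) : BlockSpace d) = L m * ‖x m‖ ^ 2 := by
    rw [weightedNormSq, Finset.sum_eq_single m (fun j _ hj => by simp [hj]) (by simp)]
    simp
  rw [e1, inner_blockGradient hπ.differentiable] at h1
  rw [e2] at h2
  have hpos : 0 < (L m : ℝ) * ‖x m‖ ^ 2 := lt_of_le_of_ne (by positivity) (Ne.symm hm)
  nlinarith

theorem sum_potential_blockSegment_le (hπ : IsBlockLogConcave π U₀ U L lam) {t : ℝ}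
    (ht₀ : 0 ≤ t) (ht : t ≤ lam) (x y : BlockSpace d) :
    ∑ k, (U₀ (blockSegment t k x y) + ∑ m, U m (blockSegment t k x y m)) ≤
      (M - t) * (U₀ x + ∑ m, U m (x m)) + t * (U₀ y + ∑ m, U m (y m)) := by
  have ht₁ : t ≤ 1 := ht.trans hπ.lam_le_one
  have hsmooth : ∀ k, U₀ (blockSegment t k x y) ≤
      U₀ x + t * inner ℝ (blockGradient k U₀ x) ((y - x) k)
        + t ^ 2 / 2 * (L k * ‖(y - x) k‖ ^ 2) := fun k => by
    have := hπ.replaceBlock_le k x (t • (y - x) k)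
    rw [inner_smul_right, norm_smul, mul_pow, Real.norm_eq_abs, sq_abs] at this
    have e : blockSegment t k x y = replaceBlock k x (x k + t • (y - x) k) := by
      rw [blockSegment, Pi.sub_apply]
      congr 1
      module
    rw [e]
    linarith
  have hconv : ∀ k, ∑ m, U m (blockSegment t k x y m) ≤
      ∑ m, U m (x m) + t * (U k (y k) - U k (x k)) := fun k => by
    rw [← Finset.add_sum_erase _ _ (Finset.mem_univ k),
      ← Finset.add_sum_erase _ (fun m => U m (x m)) (Finset.mem_univ k)]
    have e : ∑ m ∈ Finset.univ.erase k, U m (blockSegment t k x y m) =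
        ∑ m ∈ Finset.univ.erase k, U m (x m) := Finset.sum_congr rfl fun m hm => by
      rw [blockSegment, replaceBlock, Function.update_of_ne (Finset.ne_of_mem_erase hm)]
    have hc := (hπ.convex_block k).2 (Set.mem_univ (x k)) (Set.mem_univ (y k))
      (sub_nonneg.2 ht₁) ht₀ (sub_add_cancel 1 t)
    simp only [smul_eq_mul] at hc
    rw [e, blockSegment, replaceBlock, Function.update_self]
    linarith
  have hstrong := hπ.fderiv_add_le x (y - x)
  rw [add_sub_cancel, ← sum_inner_blockGradient hπ.differentiable, weightedNormSq] at hstrong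
  have hN : 0 ≤ ∑ m, (L m : ℝ) * ‖(y - x) m‖ ^ 2 := Finset.sum_nonneg fun _ _ => by positivity
  have hsum := Finset.sum_le_sum fun k (_ : k ∈ Finset.univ) => add_le_add (hsmooth k) (hconv k)
  simp only [Finset.sum_add_distrib, ← Finset.mul_sum, Finset.sum_sub_distrib, Finset.sum_const,
    Finset.card_univ, Fintype.card_fin, nsmul_eq_mul] at hsum ⊢
  -- The linear terms sum to the full derivative, bounded by `hstrong`; the remaining quadratic term
  -- is `-t (lam - t) / 2` times `‖y - x‖_L²`.
  nlinarith [mul_le_mul_of_nonneg_left hstrong ht₀,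
    mul_nonneg (mul_nonneg ht₀ (sub_nonneg.2 ht)) hN]

end IsBlockLogConcave

theorem dropBlock_blockSegment (t : ℝ) (m : Fin M) (x y : BlockSpace d) :
    dropBlock m (blockSegment t m x y) = dropBlock m x := by
  ext1 i
  exact Function.update_of_ne i.2 _ _

theorem IsBlockLogConcave.card_pos {π : Measure (BlockSpace d)} {U₀ : BlockSpace d → ℝ}
    {U : (m : Fin M) → EuclideanSpace ℝ (Fin (d m)) → ℝ} {L : Fin M → ℝ≥0} {lam : ℝ}
    (hπ : IsBlockLogConcave π U₀ U L lam) : 0 < M := by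
  obtain ⟨x, hx⟩ := hπ.weight_ne_zero
  obtain ⟨m, -, -⟩ := Finset.exists_ne_zero_of_sum_ne_zero hx
  exact m.pos

theorem IsBlockLogConcave.continuous_potential {π : Measure (BlockSpace d)}
    {U₀ : BlockSpace d → ℝ} {U : (m : Fin M) → EuclideanSpace ℝ (Fin (d m)) → ℝ}
    {L : Fin M → ℝ≥0} {lam : ℝ} (hπ : IsBlockLogConcave π U₀ U L lam) :
    Continuous fun x => U₀ x + ∑ m, U m (x m) := by
  refine hπ.contDiff.continuous.add (continuous_finsetSum _ fun m _ => ?_)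
  have : Continuous (U m) := continuousOn_univ.1 ((hπ.convex_block m).continuousOn isOpen_univ)
  exact this.comp (continuous_apply m)

/-! ### Loomis-Whitney inequality for `π` -/

/-- A Loomis-Whitney type inequality for block log-concave measures. -/
theorem IsBlockLogConcave.lintegral_prod_rpow_le {π : Measure (BlockSpace d)}
    [IsProbabilityMeasure π] {U₀ : BlockSpace d → ℝ}
    {U : (m : Fin M) → EuclideanSpace ℝ (Fin (d m)) → ℝ} {L : Fin M → ℝ≥0} {lam : ℝ}
    (hπ : IsBlockLogConcave π U₀ U L lam) {t : ℝ} (ht₀ : 0 < t) (ht : t ≤ lam) (ht₁ : t < 1)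
    {φ : (k : Fin M) → BlockCompl d k → ℝ≥0∞} (hφ : ∀ k, Measurable (φ k))
    (hφ0 : ∀ k x, φ k x ≠ 0) :
    (∫⁻ x, (∏ k, φ k (dropBlock k x)) ^ (M - t)⁻¹ ∂π) ^ (M - t) ≤
      ∏ k, ∫⁻ x, φ k (dropBlock k x) ∂π := by
  set V : BlockSpace d → ℝ := fun x => U₀ x + ∑ m, U m (x m) with hV
  have hM : (1 : ℝ) ≤ M := by exact_mod_cast hπ.card_pos
  have hp : 0 < M - t := by linarith
  set G : BlockSpace d → ℝ≥0∞ := fun x => ENNReal.ofReal (Real.exp (-V x)) with hG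
  have mG : Measurable G :=
    (Real.measurable_exp.comp hπ.continuous_potential.measurable.neg).ennreal_ofReal
  have mφ : ∀ k, Measurable fun x : BlockSpace d => φ k (dropBlock k x) := fun k =>
    (hφ k).comp (measurable_dropBlock k)
  have hG0 : ∀ x, G x ≠ 0 := fun x => by simp [hG, Real.exp_pos]
  have eπ : π = volume.withDensity G := hπ.eq_withDensity
  have hG1 : ∫⁻ x, G x = 1 := by
    rw [← setLIntegral_univ, ← withDensity_apply _ MeasurableSet.univ, ← eπ, measure_univ]
  have mψ : Measurable fun x : BlockSpace d => (∏ k, φ k (dropBlock k x)) ^ (M - t)⁻¹ :=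
    (Finset.measurable_fun_prod _ fun k _ => mφ k).pow_const _
  -- The test functions `φ` enter through `x` only: the function of `y` is the bare density, whose
  -- integral is one.
  have key := prekopa_leindler_block ht₀ ht₁ (mG.mul mψ) mG (fun k => mG.mul (mφ k))
    (fun k x => mul_ne_zero (hG0 x) (hφ0 k _)) fun x y => by
      simp only [Pi.mul_apply]
      rw [ENNReal.mul_rpow_of_nonneg _ _ hp.le, ← ENNReal.rpow_mul, inv_mul_cancel₀ hp.ne',
        ENNReal.rpow_one, Finset.prod_mul_distrib]
      simp only [dropBlock_blockSegment]
      rw [mul_right_comm]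
      gcongr
      simp only [hG]
      rw [ENNReal.ofReal_rpow_of_pos (Real.exp_pos _), ENNReal.ofReal_rpow_of_pos (Real.exp_pos _),
        ← ENNReal.ofReal_mul (by positivity), ← ENNReal.ofReal_prod_of_nonneg
          (fun _ _ => (Real.exp_pos _).le), ← Real.exp_mul, ← Real.exp_mul, ← Real.exp_add,
        ← Real.exp_sum]
      refine ENNReal.ofReal_le_ofReal (Real.exp_le_exp.2 ?_)
      have := hπ.sum_potential_blockSegment_le ht₀.le ht x y
      rw [Finset.sum_neg_distrib]
      simp only [hV]
      linarith
  rw [hG1, ENNReal.one_rpow, mul_one] at key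
  rw [eπ, lintegral_withDensity_eq_lintegral_mul _ mG mψ]
  simp only [fun k => lintegral_withDensity_eq_lintegral_mul volume mG (mφ k)]
  exact key

/-- Marginal densities may vanish, so positivity is removed by adding `1 / n` to each `φ k` and
letting `n` grow. -/
theorem IsBlockLogConcave.lintegral_prod_rpow_le_one {π : Measure (BlockSpace d)}
    [IsProbabilityMeasure π] {U₀ : BlockSpace d → ℝ}
    {U : (m : Fin M) → EuclideanSpace ℝ (Fin (d m)) → ℝ} {L : Fin M → ℝ≥0} {lam : ℝ}
    (hπ : IsBlockLogConcave π U₀ U L lam) {t : ℝ} (ht₀ : 0 < t) (ht : t ≤ lam) (ht₁ : t < 1)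
    {φ : (k : Fin M) → BlockCompl d k → ℝ≥0∞} (hφ : ∀ k, Measurable (φ k))
    (hφ1 : ∀ k, ∫⁻ x, φ k (dropBlock k x) ∂π ≤ 1) :
    ∫⁻ x, (∏ k, φ k (dropBlock k x)) ^ (M - t)⁻¹ ∂π ≤ 1 := by
  have hM : (1 : ℝ) ≤ M := by exact_mod_cast hπ.card_pos
  have hp : 0 < M - t := by linarith
  suffices h : (∫⁻ x, (∏ k, φ k (dropBlock k x)) ^ (M - t)⁻¹ ∂π) ^ (M - t) ≤ 1 by
    rwa [← ENNReal.one_rpow (M - t), ENNReal.rpow_le_rpow_iff hp] at h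
  have hlim : Filter.Tendsto (fun n : ℕ => ∏ _k : Fin M, (1 + (n : ℝ≥0∞)⁻¹)) Filter.atTop
      (nhds 1) := by
    have h1 : Filter.Tendsto (fun n : ℕ => 1 + (n : ℝ≥0∞)⁻¹) Filter.atTop (nhds (1 + 0)) :=
      tendsto_const_nhds.add ENNReal.tendsto_inv_nat_nhds_zero
    have h2 := ((ENNReal.continuous_pow M).tendsto _).comp h1
    simpa [Function.comp_def] using h2
  refine ge_of_tendsto' hlim fun n => ?_
  have hn : (n : ℝ≥0∞)⁻¹ ≠ 0 := ENNReal.inv_ne_zero.2 (ENNReal.natCast_ne_top n)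
  refine le_trans ?_ ((hπ.lintegral_prod_rpow_le ht₀ ht ht₁ (φ := fun k x => φ k x + (n : ℝ≥0∞)⁻¹)
    (fun k => (hφ k).add_const _) (fun k x => by simp [hn])).trans ?_)
  · gcongr
    exact le_self_add
  · gcongr with k
    rw [lintegral_add_right _ measurable_const, lintegral_const, measure_univ, mul_one]
    gcongr
    exact hφ1 k

/-! ### Relative entropy: subadditivity by duality, and convexity -/

theorem ae_rnDeriv_map_pos_lt_top {Ω Y : Type*} [MeasurableSpace Ω] [MeasurableSpace Y]
    {μ ν : Measure Ω} [IsFiniteMeasure μ] [IsFiniteMeasure ν] (hμν : μ ≪ ν) {T : Ω → Y}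
    (hT : Measurable T) :
    ∀ᵐ x ∂μ, 0 < (μ.map T).rnDeriv (ν.map T) (T x) ∧ (μ.map T).rnDeriv (ν.map T) (T x) < ⊤ := by
  have h := hμν.map hT
  exact ae_of_ae_map hT.aemeasurable ((Measure.rnDeriv_pos h).and
    (h.ae_le (Measure.rnDeriv_lt_top _ _)))

/-- A Loomis-Whitney type inequality implies subadditivity of the relative entropy. -/
theorem sum_klDiv_map_le {Ω ι : Type*} [MeasurableSpace Ω] [Fintype ι] {Y : ι → Type*}
    [∀ k, MeasurableSpace (Y k)] {T : ∀ k, Ω → Y k} (hT : ∀ k, Measurable (T k))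
    {μ ν : Measure Ω} [IsProbabilityMeasure μ] [IsProbabilityMeasure ν] {p : ℝ} (hp : 0 < p)
    (h : ∫⁻ x, (∏ k, (μ.map (T k)).rnDeriv (ν.map (T k)) (T k x)) ^ p⁻¹ ∂ν ≤ 1) :
    ∑ k, klDiv (μ.map (T k)) (ν.map (T k)) ≤ ENNReal.ofReal p * klDiv μ ν := by
  rcases eq_or_ne (klDiv μ ν) ⊤ with htop | htop
  · rw [htop, ENNReal.mul_top (by simpa using hp)]
    exact le_top
  obtain ⟨hμν, hint⟩ := klDiv_ne_top_iff.1 htop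
  have hPμ : ∀ k, IsProbabilityMeasure (μ.map (T k)) := fun k =>
    Measure.isProbabilityMeasure_map (hT k).aemeasurable
  have hPν : ∀ k, IsProbabilityMeasure (ν.map (T k)) := fun k =>
    Measure.isProbabilityMeasure_map (hT k).aemeasurable
  have htopk : ∀ k, klDiv (μ.map (T k)) (ν.map (T k)) ≠ ⊤ := fun k =>
    ((klDiv_map_le μ ν (hT k)).trans_lt htop.lt_top).ne
  have hintk : ∀ k, Integrable (fun x => llr (μ.map (T k)) (ν.map (T k)) (T k x)) μ := fun k =>
    (klDiv_ne_top_iff.1 (htopk k)).2.comp_measurable (hT k)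
  set ψ : Ω → ℝ≥0∞ := fun x => (∏ k, (μ.map (T k)).rnDeriv (ν.map (T k)) (T k x)) ^ p⁻¹ with hψ
  have mψ : Measurable ψ := (Finset.measurable_fun_prod _ fun k _ =>
    (Measure.measurable_rnDeriv _ _).comp (hT k)).pow_const _
  have mq : Measurable fun x => ψ x / μ.rnDeriv ν x := mψ.div (Measure.measurable_rnDeriv _ _)
  -- Only an inequality is available, since `ν` may charge the set where `dμ/dν` vanishes.
  have hq : ∫⁻ x, ψ x / μ.rnDeriv ν x ∂μ ≤ 1 := by
    rw [← lintegral_rnDeriv_mul hμν mq.aemeasurable]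
    refine le_trans (lintegral_mono fun x => ?_) h
    exact ENNReal.mul_div_le
  have hqint : Integrable (fun x => (ψ x / μ.rnDeriv ν x).toReal) μ :=
    integrable_toReal_of_lintegral_ne_top mq.aemeasurable (hq.trans_lt ENNReal.one_lt_top).ne
  have hqle : ∫ x, (ψ x / μ.rnDeriv ν x).toReal ∂μ ≤ 1 := by
    rw [integral_toReal mq.aemeasurable
      (ae_lt_top mq (hq.trans_lt ENNReal.one_lt_top).ne)]
    exact ENNReal.toReal_le_of_le_ofReal zero_le_one (by simpa using hq)
  -- The left side is `log (ψ / (dμ/dν))`, so this is `log z ≤ z - 1`; integrated against `μ`, the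
  -- right side is at most zero.
  have hpt : ∀ᵐ x ∂μ, p⁻¹ * ∑ k, llr (μ.map (T k)) (ν.map (T k)) (T k x) - llr μ ν x ≤
      (ψ x / μ.rnDeriv ν x).toReal - 1 := by
    have hk : ∀ᵐ x ∂μ, ∀ k, 0 < (μ.map (T k)).rnDeriv (ν.map (T k)) (T k x) ∧
        (μ.map (T k)).rnDeriv (ν.map (T k)) (T k x) < ⊤ :=
      ae_all_iff.2 fun k => ae_rnDeriv_map_pos_lt_top hμν (hT k)
    filter_upwards [hk, Measure.rnDeriv_pos hμν, hμν.ae_le (Measure.rnDeriv_lt_top μ ν)]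
      with x hx h0 ht
    have hk0 : ∀ k, 0 < ((μ.map (T k)).rnDeriv (ν.map (T k)) (T k x)).toReal := fun k =>
      ENNReal.toReal_pos (hx k).1.ne' (hx k).2.ne
    have hr0 : 0 < (μ.rnDeriv ν x).toReal := ENNReal.toReal_pos h0.ne' ht.ne
    have hprod := Finset.prod_pos fun k (_ : k ∈ Finset.univ) => hk0 k
    have hψx : (ψ x).toReal =
        (∏ k, ((μ.map (T k)).rnDeriv (ν.map (T k)) (T k x)).toReal) ^ p⁻¹ := by
      rw [hψ, ← ENNReal.toReal_rpow, ENNReal.toReal_prod]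
    have hψ0 : 0 < (ψ x).toReal := hψx ▸ Real.rpow_pos_of_pos hprod _
    have e : p⁻¹ * ∑ k, llr (μ.map (T k)) (ν.map (T k)) (T k x) - llr μ ν x =
        Real.log (ψ x / μ.rnDeriv ν x).toReal := by
      rw [ENNReal.toReal_div, Real.log_div hψ0.ne' hr0.ne', hψx, Real.log_rpow hprod,
        Real.log_prod fun k _ => (hk0 k).ne']
      rfl
    rw [e]
    refine Real.log_le_sub_one_of_pos ?_
    rw [ENNReal.toReal_div]
    positivity
  have hsumint := integrable_finsetSum Finset.univ fun k _ => hintk k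
  have hI := integral_mono_ae ((hsumint.const_mul p⁻¹).sub hint)
    (hqint.sub (integrable_const 1)) hpt
  simp only [Pi.sub_apply] at hI
  rw [integral_sub (hsumint.const_mul p⁻¹) hint, integral_sub hqint (integrable_const 1),
    integral_const_mul, integral_finsetSum _ fun k _ => hintk k] at hI
  have hkl : ∀ k, ∫ x, llr (μ.map (T k)) (ν.map (T k)) (T k x) ∂μ =
      (klDiv (μ.map (T k)) (ν.map (T k))).toReal := fun k => by
    rw [toReal_klDiv_of_measure_eq (hμν.map (hT k)) (by simp),
      integral_map (hT k).aemeasurable (measurable_llr _ _).aestronglyMeasurable]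
  simp only [hkl, ← toReal_klDiv_of_measure_eq hμν (by simp), integral_const, probReal_univ,
    one_smul] at hI
  have hfin : p⁻¹ * ∑ k, (klDiv (μ.map (T k)) (ν.map (T k))).toReal ≤ (klDiv μ ν).toReal := by
    linarith
  rw [inv_mul_le_iff₀ hp, ← ENNReal.toReal_sum fun k _ => htopk k] at hfin
  rw [← ENNReal.ofReal_toReal (ENNReal.sum_ne_top.2 fun k _ => htopk k),
    ← ENNReal.ofReal_toReal htop, ← ENNReal.ofReal_mul hp.le]
  exact ENNReal.ofReal_le_ofReal hfin

theorem rnDeriv_finsetSum {Ω ι : Type*} [MeasurableSpace Ω] (s : Finset ι)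
    (μ : ι → Measure Ω) [∀ i, IsFiniteMeasure (μ i)] (ν : Measure Ω) [IsFiniteMeasure ν] :
    (∑ i ∈ s, μ i).rnDeriv ν =ᵐ[ν] ∑ i ∈ s, (μ i).rnDeriv ν := by
  classical
  induction s using Finset.induction with
  | empty => simp
  | insert i s hi ih =>
    rw [Finset.sum_insert hi, Finset.sum_insert hi]
    exact (Measure.rnDeriv_add' _ _ _).trans (Filter.EventuallyEq.rfl.add ih)

/-- Convexity of the relative entropy in its first argument, for uniform mixtures. -/
theorem klDiv_inv_card_smul_sum_le {Ω ι : Type*} [MeasurableSpace Ω] [Fintype ι] [Nonempty ι]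
    (μ : ι → Measure Ω) [∀ i, IsFiniteMeasure (μ i)] (ν : Measure Ω) [IsFiniteMeasure ν] :
    klDiv ((Fintype.card ι : ℝ≥0∞)⁻¹ • ∑ i, μ i) ν ≤
      (Fintype.card ι : ℝ≥0∞)⁻¹ * ∑ i, klDiv (μ i) ν := by
  have hn : (Fintype.card ι : ℝ≥0∞) ≠ 0 := by simp
  have hn' : (Fintype.card ι : ℝ≥0∞)⁻¹ ≠ ⊤ := ENNReal.inv_ne_top.2 hn
  by_cases hac : ∀ i, μ i ≪ ν
  swap
  · push Not at hac
    obtain ⟨i, hi⟩ := hac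
    have : ∑ i, klDiv (μ i) ν = ⊤ := ENNReal.sum_eq_top.2 ⟨i, Finset.mem_univ i, by simp [hi]⟩
    rw [this, ENNReal.mul_top (by simp)]
    exact le_top
  have hsum : ∑ i, μ i ≪ ν := fun s hs => by
    simp [Measure.finsetSum_apply, fun i => hac i hs]
  have hmix : (Fintype.card ι : ℝ≥0∞)⁻¹ • ∑ i, μ i ≪ ν := hsum.smul_left _
  have hfin : IsFiniteMeasure ((Fintype.card ι : ℝ≥0∞)⁻¹ • ∑ i, μ i) :=
    Measure.smul_finite _ hn'
  have e : ∀ᵐ x ∂ν, (((Fintype.card ι : ℝ≥0∞)⁻¹ • ∑ i, μ i).rnDeriv ν x).toReal =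
      ∑ i, (Fintype.card ι : ℝ)⁻¹ • ((μ i).rnDeriv ν x).toReal := by
    have hlt : ∀ᵐ x ∂ν, ∀ i, (μ i).rnDeriv ν x < ⊤ :=
      ae_all_iff.2 fun i => Measure.rnDeriv_lt_top _ _
    filter_upwards [Measure.rnDeriv_smul_left_of_ne_top (∑ i, μ i) ν hn',
      rnDeriv_finsetSum Finset.univ μ ν, hlt] with x h1 h2 h3
    rw [h1, Pi.smul_apply, h2, Finset.sum_apply, smul_eq_mul, ENNReal.toReal_mul,
      ENNReal.toReal_sum fun i _ => (h3 i).ne, Finset.mul_sum]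
    simp
  have mk : ∀ i, Measurable fun x => ENNReal.ofReal (klFun ((μ i).rnDeriv ν x).toReal) := fun i =>
    (measurable_klFun.comp (Measure.measurable_rnDeriv _ _).ennreal_toReal).ennreal_ofReal
  rw [klDiv_eq_lintegral_klFun_of_ac hmix]
  simp only [fun i => klDiv_eq_lintegral_klFun_of_ac (hac i)]
  rw [← lintegral_finsetSum _ fun i _ => mk i,
    ← lintegral_const_mul _ (Finset.measurable_fun_sum _ fun i _ => mk i)]
  refine lintegral_mono_ae ?_
  filter_upwards [e] with x hx
  rw [hx]
  have hJ := convexOn_klFun.map_sum_le (t := Finset.univ)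
    (w := fun _ : ι => (Fintype.card ι : ℝ)⁻¹) (p := fun i => ((μ i).rnDeriv ν x).toReal)
    (fun _ _ => by positivity) (by simp) (fun i _ => ENNReal.toReal_nonneg)
  refine (ENNReal.ofReal_le_ofReal hJ).trans (le_of_eq ?_)
  simp only [smul_eq_mul]
  rw [← Finset.mul_sum, ENNReal.ofReal_mul (by positivity), ENNReal.ofReal_sum_of_nonneg
    fun i _ => klFun_nonneg ENNReal.toReal_nonneg, ENNReal.ofReal_inv_of_pos (by
      exact_mod_cast Fintype.card_pos), ENNReal.ofReal_natCast]

/-! ### Entropy along the Gibbs kernel -/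

/-- The point of `𝒳` with `m`-th block `p.2` and other blocks `p.1`. -/
def glueBlock (m : Fin M) (p : BlockCompl d m × EuclideanSpace ℝ (Fin (d m))) : BlockSpace d :=
  fun i => if h : i = m then h ▸ p.2 else p.1 ⟨i, h⟩

theorem measurable_glueBlock (m : Fin M) : Measurable (glueBlock (d := d) m) := by
  refine measurable_pi_lambda _ fun i => ?_
  by_cases h : i = m
  · subst h
    simpa [glueBlock] using measurable_snd
  · simp only [glueBlock, dif_neg h]
    exact (measurable_pi_apply (⟨i, h⟩ : {i : Fin M // i ≠ m})).comp measurable_fst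

theorem glueBlock_dropBlock (m : Fin M) (x : BlockSpace d) (y : EuclideanSpace ℝ (Fin (d m))) :
    glueBlock m (dropBlock m x, y) = replaceBlock m x y := by
  ext1 i
  by_cases h : i = m
  · subst h
    simp [glueBlock, replaceBlock]
  · simp [glueBlock, replaceBlock, dropBlock, h]

instance (π : Measure (BlockSpace d)) [IsFiniteMeasure π] (m : Fin M) :
    IsMarkovKernel (fullConditional π m) := by
  unfold fullConditional; infer_instance

theorem bind_blockKernel (π μ : Measure (BlockSpace d)) [IsFiniteMeasure π] [IsFiniteMeasure μ]
    (m : Fin M) :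
    μ.bind (blockKernel π m) =
      ((μ.map (dropBlock m)) ⊗ₘ fullConditional π m).map (glueBlock m) := by
  ext A hA
  have hB := measurable_glueBlock (d := d) m hA
  rw [Measure.bind_apply hA (blockKernel π m).aemeasurable,
    Measure.map_apply (measurable_glueBlock m) hA, Measure.compProd_apply hB,
    lintegral_map (Kernel.measurable_kernel_prodMk_left hB) (measurable_dropBlock m)]
  refine lintegral_congr fun x => ?_
  have hC : MeasurableSet (Prod.mk (dropBlock m x) ⁻¹' (glueBlock m ⁻¹' A)) :=
    measurable_prodMk_left hB
  rw [blockKernel_apply π m x hA, ← lintegral_indicator_one hC]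
  refine lintegral_congr fun y => ?_
  classical
  simp only [Set.indicator_apply, Set.mem_preimage, glueBlock_dropBlock, Pi.one_apply]

theorem map_glueBlock_compProd_fullConditional (π : Measure (BlockSpace d)) [IsFiniteMeasure π]
    (m : Fin M) :
    ((π.map (dropBlock m)) ⊗ₘ fullConditional π m).map (glueBlock m) = π := by
  rw [fullConditional, compProd_map_condDistrib (measurable_pi_apply m).aemeasurable,
    Measure.map_map (measurable_glueBlock m)
      ((measurable_dropBlock m).prodMk (measurable_pi_apply m))]
  have : glueBlock m ∘ (fun x : BlockSpace d => (dropBlock m x, x m)) = id := by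
    ext1 x
    simp [glueBlock_dropBlock, replaceBlock_self]
  rw [this, Measure.map_id]

/-- Data processing for the gluing map, then the chain rule: a shared conditional kernel adds no
entropy. -/
theorem klDiv_bind_blockKernel_le (π μ : Measure (BlockSpace d)) [IsFiniteMeasure π]
    [IsFiniteMeasure μ] (m : Fin M) :
    klDiv (μ.bind (blockKernel π m)) π ≤ klDiv (μ.map (dropBlock m)) (π.map (dropBlock m)) := by
  calc klDiv (μ.bind (blockKernel π m)) π
      = klDiv (((μ.map (dropBlock m)) ⊗ₘ fullConditional π m).map (glueBlock m))
          (((π.map (dropBlock m)) ⊗ₘ fullConditional π m).map (glueBlock m)) := by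
        rw [← bind_blockKernel, map_glueBlock_compProd_fullConditional]
    _ ≤ klDiv ((μ.map (dropBlock m)) ⊗ₘ fullConditional π m)
          ((π.map (dropBlock m)) ⊗ₘ fullConditional π m) :=
        klDiv_map_le _ _ (measurable_glueBlock m)
    _ = klDiv (μ.map (dropBlock m)) (π.map (dropBlock m)) := klDiv_compProd_left _ _ _

theorem bind_gibbsKernel (π μ : Measure (BlockSpace d)) [IsFiniteMeasure π] :
    μ.bind (gibbsKernel π) = (M : ℝ≥0∞)⁻¹ • ∑ m, μ.bind (blockKernel π m) := by
  ext A hA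
  have hm : ∀ m, Measurable fun x => blockKernel π m x A := fun m =>
    (blockKernel π m).measurable_coe hA
  rw [Measure.bind_apply hA (gibbsKernel π).aemeasurable, Measure.smul_apply,
    Measure.finsetSum_apply]
  simp only [fun m => Measure.bind_apply hA (blockKernel π m).aemeasurable (m := μ)]
  rw [← lintegral_finsetSum _ fun m _ => hm m, smul_eq_mul,
    ← lintegral_const_mul _ (Finset.measurable_fun_sum _ fun m _ => hm m)]
  refine lintegral_congr fun x => ?_
  change ((M : ℝ≥0∞)⁻¹ • ∑ m, blockKernel π m x) A = _
  rw [Measure.smul_apply, Measure.finsetSum_apply, smul_eq_mul]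

theorem klDiv_bind_gibbsKernel_le (hM : 0 < M) (π μ : Measure (BlockSpace d)) [IsFiniteMeasure π]
    [IsFiniteMeasure μ] :
    klDiv (μ.bind (gibbsKernel π)) π ≤
      (M : ℝ≥0∞)⁻¹ * ∑ m, klDiv (μ.map (dropBlock m)) (π.map (dropBlock m)) := by
  have : Nonempty (Fin M) := ⟨⟨0, hM⟩⟩
  have hfin : ∀ m, IsFiniteMeasure (μ.bind (blockKernel π m)) := fun m => by
    rw [bind_blockKernel]; infer_instance
  rw [bind_gibbsKernel]
  have h := klDiv_inv_card_smul_sum_le (fun m => μ.bind (blockKernel π m)) π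
  rw [Fintype.card_fin] at h
  refine h.trans ?_
  gcongr with m
  exact klDiv_bind_blockKernel_le π μ m

theorem klDiv_eq_zero_of_subsingleton {Y : Type*} [MeasurableSpace Y] [Subsingleton Y]
    (μ ν : Measure Y) [IsProbabilityMeasure μ] [IsProbabilityMeasure ν] : klDiv μ ν = 0 := by
  have : μ = ν := by
    ext s _
    rcases s.eq_empty_or_nonempty with rfl | hs
    · simp
    · rw [Subsingleton.eq_univ_of_nonempty hs, measure_univ, measure_univ]
  rw [this, klDiv_self]

/-- With one block, `x_{-m}` ranges over a single point. This settles the case `0 * ⊤` of the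
theorem. -/
theorem klDiv_bind_gibbsKernel_of_card_eq_one {d : Fin 1 → ℕ} (π μ : Measure (BlockSpace d))
    [IsProbabilityMeasure π] [IsProbabilityMeasure μ] :
    klDiv (μ.bind (gibbsKernel π)) π = 0 := by
  refine le_antisymm ((klDiv_bind_gibbsKernel_le one_pos π μ).trans (le_of_eq ?_)) zero_le
  have hsub : ∀ m : Fin 1, Subsingleton (BlockCompl d m) := fun m =>
    ⟨fun a b => funext fun i => absurd (Subsingleton.elim _ _) i.2⟩
  have h : ∀ m : Fin 1,
      klDiv (μ.map (dropBlock m)) (π.map (dropBlock (d := d) m)) = 0 := fun m => by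
    have := Measure.isProbabilityMeasure_map (μ := μ) (measurable_dropBlock (d := d) m).aemeasurable
    have := Measure.isProbabilityMeasure_map (μ := π) (measurable_dropBlock (d := d) m).aemeasurable
    exact klDiv_eq_zero_of_subsingleton _ _
  simp [h]

/-- The strict inequality `t < lam` ensures `t < 1`, which Prékopa-Leindler needs, even if `lam =
1`. -/
theorem IsBlockLogConcave.klDiv_bind_gibbsKernel_le {π : Measure (BlockSpace d)}
    [IsProbabilityMeasure π] {U₀ : BlockSpace d → ℝ}
    {U : (m : Fin M) → EuclideanSpace ℝ (Fin (d m)) → ℝ} {L : Fin M → ℝ≥0} {lam : ℝ}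
    (hπ : IsBlockLogConcave π U₀ U L lam) (μ : Measure (BlockSpace d)) [IsProbabilityMeasure μ]
    {t : ℝ} (ht₀ : 0 < t) (ht : t < lam) :
    klDiv (μ.bind (gibbsKernel π)) π ≤ ENNReal.ofReal (1 - t / M) * klDiv μ π := by
  have hM : (1 : ℝ) ≤ M := by exact_mod_cast hπ.card_pos
  have ht₁ : t < 1 := ht.trans_le hπ.lam_le_one
  have hp : 0 < M - t := by linarith
  have hsum : ∑ m, klDiv (μ.map (dropBlock m)) (π.map (dropBlock m)) ≤
      ENNReal.ofReal (M - t) * klDiv μ π := by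
    refine sum_klDiv_map_le measurable_dropBlock hp
      (hπ.lintegral_prod_rpow_le_one ht₀ ht.le ht₁ (fun k => Measure.measurable_rnDeriv _ _)
        fun k => ?_)
    rw [← lintegral_map (Measure.measurable_rnDeriv _ _) (measurable_dropBlock k)]
    refine (Measure.lintegral_rnDeriv_le).trans ?_
    rw [Measure.map_apply (measurable_dropBlock k) MeasurableSet.univ]
    exact prob_le_one
  refine (_root_.klDiv_bind_gibbsKernel_le hπ.card_pos π μ).trans ?_
  calc (M : ℝ≥0∞)⁻¹ * ∑ m, klDiv (μ.map (dropBlock m)) (π.map (dropBlock m))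
      ≤ (M : ℝ≥0∞)⁻¹ * (ENNReal.ofReal (M - t) * klDiv μ π) := by gcongr
    _ = ENNReal.ofReal (1 - t / M) * klDiv μ π := by
        rw [← mul_assoc, ← ENNReal.ofReal_natCast M, ← ENNReal.ofReal_inv_of_pos (by linarith),
          ← ENNReal.ofReal_mul (by positivity)]
        congr 2
        field_simp

end BlockSpace

/-! ### Passage to the limit -/

theorem mainTheorem2 {M : ℕ} {d : Fin M → ℕ}
    (π : Measure (BlockSpace d)) [IsProbabilityMeasure π]
    (U₀ : BlockSpace d → ℝ) (U : (m : Fin M) → EuclideanSpace ℝ (Fin (d m)) → ℝ)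
    (L : Fin M → ℝ≥0) (lam : ℝ) (hπ : IsBlockLogConcave π U₀ U L lam)
    (μ : Measure (BlockSpace d)) [IsProbabilityMeasure μ] :
    klDiv (μ.bind (gibbsKernel π)) π ≤
      ENNReal.ofReal (1 - 1 / (kappaStar lam * (M : ℝ))) * klDiv μ π := by
  have hM : 0 < M := hπ.card_pos
  have hM' : (0 : ℝ) < M := by exact_mod_cast hM
  have hlam := hπ.lam_pos
  have e : 1 / (kappaStar lam * (M : ℝ)) = lam / M := by
    rw [kappaStar]; field_simp
  rw [e]
  -- Multiplication by `klDiv μ π` is continuous in the limit `t → lam` only if it is finite. If it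
  -- is infinite, the right side is `⊤` unless the coefficient vanishes, which is impossible for `M
  -- ≥ 2`.
  rcases eq_or_ne (klDiv μ π) ⊤ with htop | htop
  · rcases Nat.eq_or_lt_of_le hM with rfl | hM2
    · rw [klDiv_bind_gibbsKernel_of_card_eq_one]
      exact zero_le
    · have : lam / M < 1 := by
        rw [div_lt_one hM']
        exact hπ.lam_le_one.trans_lt (by exact_mod_cast hM2)
      rw [htop, ENNReal.mul_top (by simpa using this)]
      exact le_top
  · have hlim : Filter.Tendsto (fun t : ℝ => ENNReal.ofReal (1 - t / M) * klDiv μ π)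
        (nhdsWithin lam (Set.Iio lam)) (nhds (ENNReal.ofReal (1 - lam / M) * klDiv μ π)) := by
      refine ENNReal.Tendsto.mul_const ?_ (Or.inr htop)
      have : Continuous fun t : ℝ => ENNReal.ofReal (1 - t / M) :=
        ENNReal.continuous_ofReal.comp (by fun_prop)
      exact (this.tendsto lam).mono_left nhdsWithin_le_nhds
    refine ge_of_tendsto hlim ?_
    filter_upwards [Ioo_mem_nhdsLT hlam] with t ht
    exact hπ.klDiv_bind_gibbsKernel_le μ ht.1 ht.2
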